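/- Let $q=2^n$ with $n>1$, let $\mathbb F_{q,1}=\{j\in\mathbb F_q : \mathrm{Tr}_{\mathbb F_q/\mathbb F_2}(j)=1\}$, and let $$C(x)=x\Bigl(\sum_{i=0}^{n-1}x^{2^i-1}\Bigr)^{q+1}.$$ Let $F$ be a field of characteristic $2$, let $0\ne a\in F$, and let $r,r_0,r_1$ be distinct roots of $x^{q+1}+ax+a$ in an extension field $\Omega$ of $F$ that contains $\mathbb F_q$ (for example, the separable closure of $F$). Put $y=(r_1-r)/(r_1-r_0)$. Then $y\notin\mathbb F_q$, so that $y^q+y\ne 0$ and $\mathrm{PGL}_2(\mathbb F_q)$ acts on $y$ by linear fractional transformations, with finite values. For $c\in\mathbb F_q^\times$, $j\in\mathbb F_{q,1}$ and $\gamma \in \mathrm{PGL}_2(\mathbb F_q)$ put $$e(\gamma^{-1}y,c,j)=\frac{(cz^2+z+j/c)^{q+1}}{(z^q+z)^2},\qquad z=\gamma^{-1}y .$$ Every $e(y,c,j)$ is a root of $C(x)+a$, and each root of $C(x)+a$ in $\Omega$ can be written uniquely as $e(y,c,j)$ with $c\in\mathbb F_q^\times$, $j\in\mathbb F_{q,1}$.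 For all $c\in\mathbb F_q^\times$, $j\in\mathbb F_{q,1}$ and $\gamma\in\mathrm{PGL}_2(\mathbb F_q)$, $$e(\gamma^{-1}y,c,j)=e(y,c,j)\iff\gamma\in\mathcal D_{d,c/d},\qquad\text{where } d=\sqrt j\in\mathbb F_q .$$ Here, for $d\in\mathbb F_{q,1}$ and $B\in\mathbb F_q^\times$, $$\mathcal C_{d,B}=\{1\}\cup\left\{\begin{pmatrix}A&1/B\\B&A+1/d\end{pmatrix}:A\in\mathbb F_q\right\},\qquad \mathcal D_{d,B}=\mathcal C_{d,B}\cup\mathcal C_{d,B}\begin{pmatrix}1&\frac1{dB}\\0&1\end{pmatrix}$$ in $\mathrm{PGL}_2(\mathbb F_q)$, and $\mathcal D_{d,c/d}$ is a subgroup that is dihedral of order $2(q+1)$. Consequently, $\gamma\cdot e(y,c,j)=e(\gamma^{-1}y,c,j)$ defines an action of $\mathrm{PGL}_2(\mathbb F_q)$ on the set of roots of $C(x)+a$, and the stabilizer of the root $e(y,c,j)$ is $\mathcal D_{d,c/d}$. -/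

import Mathlib

open Polynomial
open scoped MatrixGroups

/-- The elements of `K` (a finite field of characteristic 2) of absolute trace 1. -/
def traceOne (K : Type*) [Field K] [Algebra (ZMod 2) K] : Set K :=
  {j | Algebra.trace (ZMod 2) K j = 1}

/-- The Müller–Cohen–Matthews polynomial `C(x) = x T(x)^(q+1)`, where
`T(x) = ∑_{i<n} x^(2^i-1)` and `q = 2^n`. -/
noncomputable def mcmPoly (F : Type*) [Field F] (n : ℕ) : F[X] :=
  X * (∑ i ∈ Finset.range n, X ^ (2 ^ i - 1)) ^ (2 ^ n + 1)

/-- `e(y,c,j) = (c y² + y + j/c)^(q+1) / (y^q + y)²`, where `q = 2^n`. -/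
def eVal {K Ω : Type*} [Field K] [Field Ω] [Algebra K Ω] (n : ℕ) (y : Ω) (c j : K) : Ω :=
  (algebraMap K Ω c * y ^ 2 + y + algebraMap K Ω (j / c)) ^ (2 ^ n + 1) / (y ^ (2 ^ n) + y) ^ 2

/-- The linear fractional transformation `y ↦ (α y + β) / (γ y + δ)` of an invertible matrix
over `K`. -/
def mobiusGL {K Ω : Type*} [Field K] [Field Ω] [Algebra K Ω] (g : GL (Fin 2) K) (y : Ω) : Ω :=
  (algebraMap K Ω (g.val 0 0) * y + algebraMap K Ω (g.val 0 1)) /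
    (algebraMap K Ω (g.val 1 0) * y + algebraMap K Ω (g.val 1 1))

/-- The denominator in `mobiusGL` does not vanish if `y` is not in `K`. -/
theorem mobiusGL_denom_ne_zero {K Ω : Type*} [Field K] [Field Ω] [Algebra K Ω]
    (g : GL (Fin 2) K) (y : Ω) (hy : y ∉ Set.range (algebraMap K Ω)) :
    algebraMap K Ω (g.val 1 0) * y + algebraMap K Ω (g.val 1 1) ≠ 0 := by
  intro h
  have hdet : g.val.det ≠ 0 := g.det_ne_zero
  rw [Matrix.det_fin_two] at hdet
  by_cases h0 : g.val 1 0 = 0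
  · rw [h0, map_zero, zero_mul, zero_add, map_eq_zero] at h
    exact hdet (by rw [h0, h]; ring)
  · apply hy
    refine ⟨-(g.val 1 1) / g.val 1 0, ?_⟩
    have h0' : algebraMap K Ω (g.val 1 0) ≠ 0 := by simpa using h0
    rw [map_div₀, map_neg, div_eq_iff h0']
    linear_combination -h

theorem mobiusGL_mul_scalar {K Ω : Type*} [Field K] [Field Ω] [Algebra K Ω]
    (g : GL (Fin 2) K) (u : Kˣ) (y : Ω) :
    mobiusGL (g * Matrix.GeneralLinearGroup.scalar (Fin 2) u) y = mobiusGL g y := by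
  have hu : algebraMap K Ω (u : K) ≠ 0 := by simp
  have e : ∀ i k, (g * Matrix.GeneralLinearGroup.scalar (Fin 2) u).val i k = g.val i k * u := by
    intro i k
    simp
  simp only [mobiusGL, e, map_mul]
  rw [← mul_div_mul_right _ (algebraMap K Ω (g.val 1 0) * y + algebraMap K Ω (g.val 1 1)) hu]
  congr 1 <;> ring

/-- The action of `PGL₂(K)` on elements `y ∉ K` of an extension field by linear fractional
transformations. -/
def mobius {K Ω : Type*} [Field K] [Field Ω] [Algebra K Ω] (γ : PGL(2, K)) (y : Ω) : Ω :=
  Quotient.lift (fun g : GL (Fin 2) K => mobiusGL g y)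
    (fun g h hgh => by
      have hm : Matrix.ProjGenLinGroup.mk g = Matrix.ProjGenLinGroup.mk h := Quotient.sound hgh
      obtain ⟨u, rfl⟩ := Matrix.ProjGenLinGroup.mk_eq_mk_iff.mp hm
      exact (mobiusGL_mul_scalar g u y).symm) γ

theorem mobius_mk {K Ω : Type*} [Field K] [Field Ω] [Algebra K Ω] (g : GL (Fin 2) K) (y : Ω) :
    mobius (Matrix.ProjGenLinGroup.mk g) y = mobiusGL g y := rfl

/-- The set `𝒞_{j,C} = {M_A : A ∈ P¹(K)}` in `PGL₂(K)`, where `M_∞ = 1` and `M_A` is the class of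
the matrix with rows `(A, 1/C)` and `(C, A + 1/j)` for `A ∈ K`. -/
def cyclicSet {K : Type*} [Field K] (j C : K) : Set (PGL(2, K)) :=
  {γ | γ = 1 ∨ ∃ (A : K) (g : GL (Fin 2) K),
    g.val = !![A, 1 / C; C, A + 1 / j] ∧ γ = Matrix.ProjGenLinGroup.mk g}

/-- The set `𝒟_{j,C} = 𝒞_{j,C} ∪ {M_A · (1, 1/(jC); 0, 1) : A ∈ P¹(K)}` in `PGL₂(K)`. -/
def dihedralSet {K : Type*} [Field K] (j C : K) : Set (PGL(2, K)) :=
  cyclicSet j C ∪ {γ | ∃ m ∈ cyclicSet j C, γ =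
    m * Matrix.ProjGenLinGroup.mk (Matrix.GeneralLinearGroup.upperRightHom (1 / (j * C)))}

/-! Write `D = y^q + y` and `P = c y² + y + j/c`. The three roots give `a = (D^q + D)^(q+1) /
D^(q²+1)` (`param_of_roots`). On the other side `P^q = P + c D² + D`, so `e = P^(q+1)/D²` is `j`
plus two expressions `h² + h`; its sum of `2^i`-th powers telescopes (`sum_eVal_pow`), and this
yields both `C(e) = a` and the recovery of `(c, j)` from `e`. There are `(q-1) q/2` pairs, which is
also the degree of `C`, so all roots are reached.

For the action, `(c, j)` encodes the binary form `c X² + XY + (j/c) Y²`. In characteristic 2 its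
polar form is the determinant, so substituting `g` and dividing by `det g` gives a form of the same
shape, and `Tr j` survives as the Arf invariant. This describes `e(γy, c, j)` (`eVal_mobiusGL`). The
stabilizer consists of the `g` that scale the form by `det g`: a nonsplit torus `K[ω]ˣ/Kˣ`, cyclic
of order `q + 1`, extended by an involution inverting it. -/

/-! ### Frobenius powers and traces over the finite field. -/

theorem mem_range_algebraMap_of_pow_card_eq {K Ω : Type*} [Field K] [Finite K] [Field Ω]
    [Algebra K Ω] {y : Ω} (h : y ^ Nat.card K = y) : y ∈ Set.range (algebraMap K Ω) := by
  have := Fintype.ofFinite K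
  rw [Nat.card_eq_fintype_card] at h
  have hm : (X ^ Fintype.card K - X : K[X]).Monic :=
    monic_X_pow_sub (by simpa using Fintype.one_lt_card)
  have hd : (X ^ Fintype.card K - X : K[X]).natDegree = Fintype.card K :=
    FiniteField.X_pow_card_sub_X_natDegree_eq K Fintype.one_lt_card
  have hp := prod_multiset_X_sub_C_of_monic_of_roots_card_eq hm (by
    rw [FiniteField.roots_X_pow_card_sub_X, hd]; simp)
  rw [FiniteField.roots_X_pow_card_sub_X] at hp
  have h0 := congrArg (aeval y) hp
  rw [map_sub, map_pow, aeval_X, h, sub_self, map_multiset_prod, Multiset.prod_eq_zero_iff,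
    Multiset.mem_map] at h0
  obtain ⟨p, hp, h0⟩ := h0
  obtain ⟨i, -, rfl⟩ := Multiset.mem_map.mp hp
  exact ⟨i, (sub_eq_zero.mp (by simpa using h0)).symm⟩

theorem sum_pow_two_pow_sq_add_self {R : Type*} [CommRing R] [CharP R 2] (h : R) (n : ℕ) :
    ∑ i ∈ Finset.range n, (h ^ 2 + h) ^ (2 ^ i) = h ^ (2 ^ n) + h := by
  induction n with
  | zero => simp [CharTwo.add_self_eq_zero]
  | succ n ih =>
    rw [Finset.sum_range_succ, ih, add_pow_char_pow, ← pow_mul, ← pow_succ']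
    have := CharTwo.add_self_eq_zero (h ^ 2 ^ n)
    linear_combination this

theorem sum_pow_two_pow_add {R : Type*} [CommRing R] [CharP R 2] (g h : R) (n : ℕ) :
    ∑ i ∈ Finset.range n, (g + h) ^ (2 ^ i) =
      ∑ i ∈ Finset.range n, g ^ (2 ^ i) + ∑ i ∈ Finset.range n, h ^ (2 ^ i) := by
  simp only [add_pow_char_pow, Finset.sum_add_distrib]

theorem finrank_zmod_two {n : ℕ} {K : Type*} [Field K] [Finite K] [Algebra (ZMod 2) K]
    (hK : Nat.card K = 2 ^ n) : Module.finrank (ZMod 2) K = n := by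
  have h := Module.natCard_eq_pow_finrank (K := ZMod 2) (V := K)
  rw [hK, Nat.card_zmod] at h
  exact (Nat.pow_right_injective le_rfl h).symm

theorem sum_algebraMap_pow_of_mem_traceOne {n : ℕ} {K Ω : Type*} [Field K] [Finite K]
    [Algebra (ZMod 2) K] [Field Ω] [Algebra K Ω] (hK : Nat.card K = 2 ^ n) {j : K}
    (hj : j ∈ traceOne K) : ∑ i ∈ Finset.range n, (algebraMap K Ω j) ^ (2 ^ i) = 1 := by
  have h := FiniteField.algebraMap_trace_eq_sum_pow (ZMod 2) K j
  rw [show Algebra.trace (ZMod 2) K j = 1 from hj, finrank_zmod_two hK, map_one,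
    Nat.card_zmod] at h
  simpa using (congrArg (algebraMap K Ω) h).symm

theorem trace_sq {K : Type*} [Field K] [Finite K] [Algebra (ZMod 2) K] (t : K) :
    Algebra.trace (ZMod 2) K (t ^ 2) = Algebra.trace (ZMod 2) K t := by
  have := Fintype.ofFinite K
  let φ : K ≃ₐ[ZMod 2] K := FiniteField.frobeniusAlgEquivOfAlgebraic (ZMod 2) K
  have h : φ t = t ^ 2 := by simp [φ]
  rw [← h, Algebra.trace_eq_of_algEquiv]

theorem algebraMap_pow_two_pow {n : ℕ} {K Ω : Type*} [Field K] [Finite K]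
    [Field Ω] [Algebra K Ω] (hK : Nat.card K = 2 ^ n) (c : K) :
    algebraMap K Ω c ^ (2 ^ n) = algebraMap K Ω c := by
  have := Fintype.ofFinite K
  rw [← map_pow, ← hK, Nat.card_eq_fintype_card, FiniteField.pow_card]

/-! ### The coefficient in terms of `y`. -/

/-- If `y` is the ratio of differences of three roots of `x^(q+1) + A x + A`, then
`A = (D^q + D)^(q+1) / D^(q²+1)`, where `D = y^q + y ≠ 0`. -/
theorem param_of_roots {Ω : Type*} [Field Ω] [CharP Ω 2] (n : ℕ) {A r r₀ r₁ y : Ω} (hA : A ≠ 0)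
    (hr : r ^ (2 ^ n + 1) + A * r + A = 0) (hr₀ : r₀ ^ (2 ^ n + 1) + A * r₀ + A = 0)
    (hr₁ : r₁ ^ (2 ^ n + 1) + A * r₁ + A = 0) (h₀ : r ≠ r₀) (h₁ : r ≠ r₁) (h₀₁ : r₀ ≠ r₁)
    (hy : y = (r₁ - r) / (r₁ - r₀)) :
    y ^ (2 ^ n) + y ≠ 0 ∧
    A * ((y ^ (2 ^ n) + y) * ((y ^ (2 ^ n) + y) ^ (2 ^ n)) ^ (2 ^ n)) =
      ((y ^ (2 ^ n) + y) ^ (2 ^ n) + (y ^ (2 ^ n) + y)) ^ (2 ^ n + 1) := by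
  have h2 : (2 : Ω) = 0 := CharTwo.two_eq_zero
  have e0 : r₁ - r₀ ≠ 0 := sub_ne_zero.mpr h₀₁.symm
  have e1 : r₁ - r ≠ 0 := sub_ne_zero.mpr h₁.symm
  have hR : r₁ ≠ 0 := by
    rintro rfl
    simp [hA] at hr₁
  -- the linearized equation at a root
  have key : ∀ s, s ^ (2 ^ n + 1) + A * s + A = 0 → r₁ - s ≠ 0 →
      r₁ * (1 / (r₁ - s)) + (r₁ ^ (2 ^ n) + A) * (1 / (r₁ - s)) ^ (2 ^ n) = 1 := by
    intro s hs hne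
    have hq : (r₁ - s) ^ (2 ^ n) = r₁ ^ (2 ^ n) - s ^ (2 ^ n) := sub_pow_char_pow ..
    have hq0 : (r₁ - s) ^ (2 ^ n) ≠ 0 := pow_ne_zero _ hne
    rw [div_pow, one_pow]
    rw [pow_succ] at hs hr₁
    have : r₁ * (r₁ - s) ^ (2 ^ n) + (r₁ ^ (2 ^ n) + A) * (r₁ - s) =
        (r₁ - s) * (r₁ - s) ^ (2 ^ n) := by
      rw [hq]; grind
    field_simp
    linear_combination this
  have k0 := key r₀ hr₀ e0
  have k1 := key r hr e1
  set u := 1 / (r₁ - r) with hu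
  have hu0 : 1 / (r₁ - r₀) = y * u := by
    rw [hy, hu]; field_simp
  have hy1 : y + 1 ≠ 0 := by
    intro h
    apply h₀
    have : y = 1 := by linear_combination h - h2
    rw [this, eq_comm, div_eq_one_iff_eq e0] at hy
    linear_combination -hy
  rw [hu0, mul_pow] at k0
  have hD : y ^ (2 ^ n) + y ≠ 0 := by
    intro h
    apply hy1
    have : y ^ (2 ^ n) = y := by linear_combination h - y * h2
    rw [this] at k0
    linear_combination y * k1 - k0 + h2 * y
  refine ⟨hD, ?_⟩
  have frob : ∀ s t : Ω, (s + t) ^ (2 ^ n) = s ^ (2 ^ n) + t ^ (2 ^ n) :=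
    fun s t => add_pow_char_pow ..
  have hyq1 : y ^ (2 ^ n) + 1 ≠ 0 := by
    have := pow_ne_zero (2 ^ n) hy1
    rwa [frob, one_pow] at this
  have hyqq1 : (y ^ (2 ^ n)) ^ (2 ^ n) + 1 ≠ 0 := by
    have := pow_ne_zero (2 ^ n) hyq1
    rwa [frob, one_pow] at this
  -- Both `u` and `y u` solve `r₁ w + (r₁^q + A) w^q = 1`. Cramer's rule, with determinant `D = y^q
  -- + y`, gives `b1` and `b2`.
  have b1 : (r₁ ^ (2 ^ n) + A) * u ^ (2 ^ n) * (y ^ (2 ^ n) + y) = y + 1 := by grind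
  have b2 : r₁ * u * (y ^ (2 ^ n) + y) = y ^ (2 ^ n) + 1 := by grind
  have b3 : r₁ ^ (2 ^ n) * u ^ (2 ^ n) * (y ^ (2 ^ n) + y) ^ (2 ^ n) =
      (y ^ (2 ^ n)) ^ (2 ^ n) + 1 := by
    rw [← mul_pow, ← mul_pow, b2, frob, one_pow]
  have hRb : r₁ * (r₁ ^ (2 ^ n) + A) = A := by
    rw [pow_succ] at hr₁
    linear_combination hr₁ - h2 * A
  have hb : r₁ ^ (2 ^ n) + A ≠ 0 := by
    intro h
    rw [h, mul_zero] at hRb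
    exact hA hRb.symm
  have hRq : r₁ ^ (2 ^ n) = (r₁ ^ (2 ^ n) + A) * (r₁ + 1) := by
    linear_combination -hRb - A * h2
  have b4 : (r₁ + 1) * (y + 1) * (y ^ (2 ^ n) + y) ^ (2 ^ n) =
      (y ^ (2 ^ n) + y) * ((y ^ (2 ^ n)) ^ (2 ^ n) + 1) := by
    apply mul_left_cancel₀ hb
    rw [← b1, ← b3]
    linear_combination (-(r₁ ^ (2 ^ n) + A) * u ^ (2 ^ n) * (y ^ (2 ^ n) + y) *
      (y ^ (2 ^ n) + y) ^ (2 ^ n)) * hRq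
  have b5 : r₁ * (y + 1) * (y ^ (2 ^ n) + y) ^ (2 ^ n) =
      (y ^ (2 ^ n) + 1) * ((y ^ (2 ^ n) + y) ^ (2 ^ n) + (y ^ (2 ^ n) + y)) := by
    have := frob (y ^ (2 ^ n)) y
    grind
  have b6 : r₁ ^ (2 ^ n) * (y ^ (2 ^ n) + 1) * ((y ^ (2 ^ n) + y) ^ (2 ^ n)) ^ (2 ^ n) =
      ((y ^ (2 ^ n)) ^ (2 ^ n) + 1) *
        ((y ^ (2 ^ n) + y) ^ (2 ^ n) + (y ^ (2 ^ n) + y)) ^ (2 ^ n) := by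
    have := congrArg (· ^ (2 ^ n)) b5
    simp only [mul_pow] at this
    rwa [frob y 1, frob (y ^ 2 ^ n) 1, one_pow] at this
  rw [pow_succ _ (2 ^ n)]
  -- The factor `(y^q + 1)(y^(q²) + 1)` makes `b4`, `b5` and `b6` applicable, and `r₁` then cancels
  -- through `A (r₁ + 1) = r₁^(q+1)`.
  apply mul_left_cancel₀ (mul_ne_zero hyq1 hyqq1)
  rw [pow_succ] at hr₁
  generalize ((y ^ (2 ^ n) + y) ^ (2 ^ n)) ^ (2 ^ n) = Dqq at *
  generalize ((y ^ (2 ^ n) + y) ^ (2 ^ n) + (y ^ (2 ^ n) + y)) ^ (2 ^ n) = Nq at *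
  generalize (y ^ (2 ^ n)) ^ (2 ^ n) = yqq at *
  generalize hDq : (y ^ (2 ^ n) + y) ^ (2 ^ n) = Dq at *
  generalize y ^ (2 ^ n) = yq at *
  generalize r₁ ^ (2 ^ n) = Rq at *
  have hRR : A * (r₁ + 1) = r₁ * Rq := by linear_combination -hr₁ + (A * r₁ + A) * h2
  calc _ = A * ((yq + y) * (yqq + 1)) * (yq + 1) * Dqq := by ring
    _ = (A * (r₁ + 1)) * ((y + 1) * Dq) * (yq + 1) * Dqq := by rw [← b4]; ring
    _ = (r₁ * (y + 1) * Dq) * (Rq * (yq + 1) * Dqq) := by rw [hRR]; ring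
    _ = _ := by rw [b5, b6]; ring

/-! ### The values `e(y,c,j)` as distinct roots. -/

section eVal

variable {n : ℕ} {K Ω : Type*} [Field K] [Finite K] [Field Ω] [CharP Ω 2] [Algebra K Ω]

theorem quadratic_pow_two_pow (hK : Nat.card K = 2 ^ n) (y : Ω) (c j : K) :
    (algebraMap K Ω c * y ^ 2 + y + algebraMap K Ω (j / c)) ^ (2 ^ n) =
      (algebraMap K Ω c * y ^ 2 + y + algebraMap K Ω (j / c)) +
        algebraMap K Ω c * (y ^ (2 ^ n) + y) ^ 2 + (y ^ (2 ^ n) + y) := by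
  have h2 : (2 : Ω) = 0 := CharTwo.two_eq_zero
  rw [add_pow_char_pow, add_pow_char_pow, mul_pow, algebraMap_pow_two_pow hK,
    algebraMap_pow_two_pow hK, pow_right_comm]
  grind

/-- Here `e = (P/D)² + P/D + (c y)² + c y + j`. The sum telescopes to `P^q/D^q + P/D + c D + Tr j`.
Since `Tr j = 1`, the last three terms combine to `P^q/D`. -/
theorem sum_eVal_pow [Algebra (ZMod 2) K] (hK : Nat.card K = 2 ^ n) {y : Ω} (hD : y ^ (2 ^ n) + y ≠ 0) {c j : K}
    (hc : c ≠ 0) (hj : j ∈ traceOne K) :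
    ∑ i ∈ Finset.range n, eVal n y c j ^ (2 ^ i) =
      (algebraMap K Ω c * y ^ 2 + y + algebraMap K Ω (j / c)) ^ (2 ^ n) *
        ((y ^ (2 ^ n) + y) ^ (2 ^ n) + (y ^ (2 ^ n) + y)) /
          ((y ^ (2 ^ n) + y) * (y ^ (2 ^ n) + y) ^ (2 ^ n)) := by
  have h2 : (2 : Ω) = 0 := CharTwo.two_eq_zero
  have hP := quadratic_pow_two_pow hK y c j
  have hc' : algebraMap K Ω c ≠ 0 := by simpa using hc
  have hjc : algebraMap K Ω c * algebraMap K Ω (j / c) = algebraMap K Ω j := by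
    rw [← map_mul, mul_div_cancel₀ _ hc]
  have hcq := algebraMap_pow_two_pow (Ω := Ω) hK c
  have hD' := pow_ne_zero (2 ^ n) hD
  have he : eVal n y c j =
      (((algebraMap K Ω c * y ^ 2 + y + algebraMap K Ω (j / c)) / (y ^ (2 ^ n) + y)) ^ 2 +
        (algebraMap K Ω c * y ^ 2 + y + algebraMap K Ω (j / c)) / (y ^ (2 ^ n) + y)) +
      ((algebraMap K Ω c * y) ^ 2 + algebraMap K Ω c * y) + algebraMap K Ω j := by
    rw [eVal, pow_succ, hP, ← hjc]
    field_simp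
    ring
  rw [he, sum_pow_two_pow_add, sum_pow_two_pow_add, sum_pow_two_pow_sq_add_self,
    sum_pow_two_pow_sq_add_self, sum_algebraMap_pow_of_mem_traceOne hK hj, div_pow, mul_pow, hcq]
  generalize (algebraMap K Ω c * y ^ 2 + y + algebraMap K Ω (j / c)) ^ 2 ^ n = Pq at *
  generalize (algebraMap K Ω c * y ^ 2 + y + algebraMap K Ω (j / c)) = P at *
  subst hP
  generalize (y ^ (2 ^ n) + y) ^ 2 ^ n = Dq at *
  field_simp
  grind

/-- If `P = 0`, then `c D² + D = 0`, so `D = 1/c` lies in `K` and `D^q + D = 0`. -/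
theorem eVal_quadratic_ne_zero (hK : Nat.card K = 2 ^ n) {y : Ω} (hD : y ^ (2 ^ n) + y ≠ 0)
    (hN : (y ^ (2 ^ n) + y) ^ (2 ^ n) + (y ^ (2 ^ n) + y) ≠ 0) {c : K} (hc : c ≠ 0) (j : K) :
    algebraMap K Ω c * y ^ 2 + y + algebraMap K Ω (j / c) ≠ 0 := by
  have h2 : (2 : Ω) = 0 := CharTwo.two_eq_zero
  have hc' : algebraMap K Ω c ≠ 0 := by simpa using hc
  intro h
  have hP := quadratic_pow_two_pow hK y c j
  rw [h, zero_pow (by positivity), zero_add] at hP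
  have h1 : (y ^ (2 ^ n) + y) = algebraMap K Ω (c⁻¹) := by
    rw [map_inv₀, ← one_div, eq_div_iff hc']
    apply mul_left_cancel₀ hD
    linear_combination -hP - h2 * (y ^ (2 ^ n) + y)
  apply hN
  rw [h1, algebraMap_pow_two_pow hK, CharTwo.add_self_eq_zero]

theorem mul_sum_pow_sub_one {R : Type*} [CommRing R] (x : R) (n : ℕ) :
    x * ∑ i ∈ Finset.range n, x ^ (2 ^ i - 1) = ∑ i ∈ Finset.range n, x ^ (2 ^ i) := by
  rw [Finset.mul_sum]
  refine Finset.sum_congr rfl fun i _ => ?_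
  rw [← pow_succ', Nat.sub_add_cancel Nat.one_le_two_pow]

theorem eVal_root [Algebra (ZMod 2) K] (hK : Nat.card K = 2 ^ n) {y A : Ω} (hA : A ≠ 0) (hD : y ^ (2 ^ n) + y ≠ 0)
    (hp : A * ((y ^ (2 ^ n) + y) * ((y ^ (2 ^ n) + y) ^ (2 ^ n)) ^ (2 ^ n)) =
      ((y ^ (2 ^ n) + y) ^ (2 ^ n) + (y ^ (2 ^ n) + y)) ^ (2 ^ n + 1)) {c j : K}
    (hc : c ≠ 0) (hj : j ∈ traceOne K) :
    eVal n y c j * (∑ i ∈ Finset.range n, eVal n y c j ^ (2 ^ i - 1)) ^ (2 ^ n + 1) + A = 0 := by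
  have hD1 := pow_ne_zero (2 ^ n) hD
  have hD2 := pow_ne_zero (2 ^ n) hD1
  have hN : (y ^ (2 ^ n) + y) ^ (2 ^ n) + (y ^ (2 ^ n) + y) ≠ 0 := by
    intro h
    rw [h, zero_pow (by positivity)] at hp
    exact mul_ne_zero hA (mul_ne_zero hD hD2) hp
  have hP0 := eVal_quadratic_ne_zero hK hD hN hc j
  have he : eVal n y c j ≠ 0 := by
    rw [eVal]
    exact div_ne_zero (pow_ne_zero _ hP0) (pow_ne_zero _ hD)
  -- Multiplication by `e^q` turns `C(e)` into the `(q+1)`-st power of `∑ e^(2^i)`.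
  apply mul_left_cancel₀ (pow_ne_zero (2 ^ n) he)
  have h1 : eVal n y c j ^ 2 ^ n *
      (eVal n y c j * (∑ i ∈ Finset.range n, eVal n y c j ^ (2 ^ i - 1)) ^ (2 ^ n + 1)) =
      (∑ i ∈ Finset.range n, eVal n y c j ^ (2 ^ i)) ^ (2 ^ n + 1) := by
    rw [← mul_sum_pow_sub_one, mul_pow, pow_succ]; ring
  have h3 : eVal n y c j ^ 2 ^ n =
      ((algebraMap K Ω c * y ^ 2 + y + algebraMap K Ω (j / c)) ^ (2 ^ n)) ^ (2 ^ n) *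
        (algebraMap K Ω c * y ^ 2 + y + algebraMap K Ω (j / c)) ^ (2 ^ n) /
          ((y ^ (2 ^ n) + y) ^ (2 ^ n)) ^ 2 := by
    rw [eVal, div_pow, pow_succ, mul_pow, pow_right_comm _ 2 (2 ^ n)]
  rw [mul_add, h1, sum_eVal_pow hK hD hc hj, mul_zero, CharTwo.add_eq_zero, h3,
    div_pow, mul_pow, ← hp, pow_succ _ (2 ^ n), pow_succ _ (2 ^ n), mul_pow]
  generalize ((y ^ (2 ^ n) + y) ^ 2 ^ n) ^ 2 ^ n = Dqq at *
  generalize (y ^ (2 ^ n) + y) ^ 2 ^ n = Dq at *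
  field_simp

/-- By `sum_eVal_pow`, `e` determines `P^q`, hence `P`. Two expressions for `P` with different `c`
would put `y²`, and so `y`, in `K`. -/
theorem eVal_injective [Algebra (ZMod 2) K] (hK : Nat.card K = 2 ^ n) {y : Ω} (hy : y ∉ Set.range (algebraMap K Ω))
    (hD : y ^ (2 ^ n) + y ≠ 0)
    (hN : (y ^ (2 ^ n) + y) ^ (2 ^ n) + (y ^ (2 ^ n) + y) ≠ 0) {c j c' j' : K}
    (hc : c ≠ 0) (hc' : c' ≠ 0) (hj : j ∈ traceOne K) (hj' : j' ∈ traceOne K)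
    (h : eVal n y c j = eVal n y c' j') : c = c' ∧ j = j' := by
  have h2 : (2 : Ω) = 0 := CharTwo.two_eq_zero
  have hinj := (algebraMap K Ω).injective
  have hD1 := pow_ne_zero (2 ^ n) hD
  have hs := sum_eVal_pow hK hD hc hj
  rw [h, sum_eVal_pow hK hD hc' hj', div_left_inj' (mul_ne_zero hD hD1),
    mul_left_inj' hN] at hs
  replace hs : algebraMap K Ω c' * y ^ 2 + y + algebraMap K Ω (j' / c') =
      algebraMap K Ω c * y ^ 2 + y + algebraMap K Ω (j / c) := iterateFrobenius_inj Ω 2 n hs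
  have hcc : c = c' := by
    by_contra hne
    have hcc' : algebraMap K Ω c - algebraMap K Ω c' ≠ 0 := by
      rwa [sub_ne_zero, hinj.ne_iff]
    have hy2 : y ^ 2 = algebraMap K Ω ((j' / c' - j / c) / (c - c')) := by
      rw [map_div₀, map_sub, map_sub, eq_div_iff hcc']
      linear_combination -hs
    apply hy
    apply mem_range_algebraMap_of_pow_card_eq
    apply frobenius_inj Ω 2
    rw [frobenius_def, frobenius_def, hK, pow_right_comm, hy2, algebraMap_pow_two_pow hK]
  subst hcc
  refine ⟨rfl, ?_⟩
  have := hinj (add_left_cancel hs)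
  rwa [div_left_inj' hc, eq_comm] at this

end eVal

/-! ### Dihedral subgroups of `PGL₂(K)`. -/

theorem exists_subgroup_mulEquiv_dihedralGroup {G : Type*} [Group G] (C : Subgroup G) [IsCyclic C]
    (t : G) (ht : t * t = 1) (htC : t ∉ C) (hconj : ∀ x ∈ C, t * x * t = x⁻¹) :
    ∃ H : Subgroup G, (H : Set G) = (C : Set G) ∪ {γ | ∃ m ∈ (C : Set G), γ = m * t} ∧
      Nonempty (H ≃* DihedralGroup (Nat.card C)) := by
  let f := zmodCyclicMulEquiv (G := C) inferInstance
  let F : ZMod (Nat.card C) → G := fun i => (f (Multiplicative.ofAdd i) : G)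
  have hF : ∀ i j, F (i + j) = F i * F j := fun i j => by simp [F, ofAdd_add]
  have hFC : ∀ i, F i ∈ C := fun i => (f _).2
  have hFneg : ∀ i, F (-i) = (F i)⁻¹ := fun i => by simp [F, ofAdd_neg]
  have hFt : ∀ i, t * F i * t = F (-i) := fun i => by rw [hconj _ (hFC i), hFneg]
  have hFt' : ∀ i, F i * t = t * F (-i) := fun i => by
    rw [← hFt, ← mul_assoc, ← mul_assoc, ht, one_mul]
  have hFinj : Function.Injective F := fun i j h =>
    Multiplicative.ofAdd.injective (f.injective (Subtype.ext h))
  have hFsurj : ∀ x ∈ C, ∃ i, F i = x := fun x hx => by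
    obtain ⟨i, hi⟩ := f.surjective ⟨x, hx⟩
    exact ⟨i.toAdd, by simp [F, hi]⟩
  let ψ : DihedralGroup (Nat.card C) →* G := MonoidHom.mk'
    (fun | .r i => F i | .sr i => t * F i) (by
      rintro (i | i) (j | j)
      · exact hF i j
      · change t * F (j - i) = F i * (t * F j)
        rw [← mul_assoc, hFt', mul_assoc, ← hF, neg_add_eq_sub]
      · change t * F (i + j) = t * F i * F j
        rw [hF, mul_assoc]
      · change F (j - i) = t * F i * (t * F j)
        rw [← mul_assoc, hFt, ← hF, neg_add_eq_sub])
  have hψ : Function.Injective ψ := by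
    rintro (i | i) (j | j) (h : _ = _)
    · exact congrArg _ (hFinj h)
    · change F i = t * F j at h
      refine absurd ?_ htC
      rw [eq_mul_inv_iff_mul_eq.mpr h.symm]
      exact C.mul_mem (hFC i) (C.inv_mem (hFC j))
    · change t * F i = F j at h
      refine absurd ?_ htC
      rw [eq_mul_inv_iff_mul_eq.mpr h]
      exact C.mul_mem (hFC j) (C.inv_mem (hFC i))
    · exact congrArg _ (hFinj (mul_left_cancel (h : t * F i = t * F j)))
  refine ⟨ψ.range, ?_, ⟨(MonoidHom.ofInjective hψ).symm⟩⟩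
  ext x
  constructor
  · rintro ⟨i | i, rfl⟩
    · exact Or.inl (hFC i)
    · refine Or.inr ⟨F (-i), hFC _, ?_⟩
      rw [hFt', neg_neg]; rfl
  · rintro (hx | ⟨m, hm, rfl⟩)
    · obtain ⟨i, rfl⟩ := hFsurj x hx
      exact ⟨.r i, rfl⟩
    · obtain ⟨i, rfl⟩ := hFsurj m hm
      exact ⟨.sr (-i), (hFt' i).symm⟩

section PGL

variable {K : Type*} [Field K]

theorem mk_eq_mk_of_smul {g h : GL (Fin 2) K} (u : Kˣ) (H : ∀ i j, g.val i j * u = h.val i j) :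
    Matrix.ProjGenLinGroup.mk g = Matrix.ProjGenLinGroup.mk h := by
  refine Matrix.ProjGenLinGroup.mk_eq_mk_iff.mpr ⟨u, ?_⟩
  ext i j
  simpa using H i j

theorem exists_smul_of_mk_eq_mk {g h : GL (Fin 2) K}
    (H : Matrix.ProjGenLinGroup.mk g = Matrix.ProjGenLinGroup.mk h) :
    ∃ u : Kˣ, ∀ i j, g.val i j * u = h.val i j := by
  obtain ⟨u, rfl⟩ := Matrix.ProjGenLinGroup.mk_eq_mk_iff.mp H
  exact ⟨u, fun i j => by simp⟩

/-- Homogeneous linear equations in the entries do not depend on the representative, and they absorb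
the exceptional element `1` as the case of lower left entry `0`. -/
theorem mk_mem_cyclicSet_iff {c d : K} (hc : c ≠ 0) (hd : d ≠ 0) (g : GL (Fin 2) K) :
    Matrix.ProjGenLinGroup.mk g ∈ cyclicSet d (c / d) ↔
      g.val 0 1 = g.val 1 0 * d ^ 2 / c ^ 2 ∧ g.val 1 1 = g.val 0 0 + g.val 1 0 / c := by
  constructor
  · rintro (h | ⟨A, h, hA, hgh⟩)
    · rw [← Matrix.ProjGenLinGroup.mk_one] at h
      obtain ⟨u, hu⟩ := exists_smul_of_mk_eq_mk h.symm
      simp [← hu]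
    · obtain ⟨u, hu⟩ := exists_smul_of_mk_eq_mk hgh.symm
      simp only [← hu, hA]
      simp only [Matrix.of_apply, Matrix.cons_val', Matrix.cons_val_zero, Matrix.cons_val_one,
        Matrix.cons_val_fin_one]
      constructor <;> field_simp
  · rintro ⟨h1, h2⟩
    by_cases h0 : g.val 1 0 = 0
    · left
      rw [h0, zero_mul, zero_div] at h1
      rw [h0, zero_div, add_zero] at h2
      have h3 : g.val 0 0 ≠ 0 := by
        intro h3
        have := g.det_ne_zero
        rw [Matrix.det_fin_two, h0, h3] at this
        simp at this
      rw [← Matrix.ProjGenLinGroup.mk_one]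
      refine (mk_eq_mk_of_smul (Units.mk0 _ h3) ?_).symm
      intro i j
      fin_cases i <;> fin_cases j <;> simp [h0, h1, h2]
    · right
      -- This scalar normalizes the lower left entry to `c / d`.
      have hu : c / (d * g.val 1 0) ≠ 0 := div_ne_zero hc (mul_ne_zero hd h0)
      refine ⟨g.val 0 0 * (c / (d * g.val 1 0)),
        g * Matrix.GeneralLinearGroup.scalar (Fin 2) (Units.mk0 _ hu), ?_, by simp⟩
      ext i j
      fin_cases i <;> fin_cases j <;> simp [h1, h2] <;> field_simp

theorem upperRightHom_mul_self [CharP K 2] (x : K) :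
    Matrix.GeneralLinearGroup.upperRightHom x * Matrix.GeneralLinearGroup.upperRightHom x = 1 := by
  rw [← AddChar.map_add_eq_mul, CharTwo.add_self_eq_zero, AddChar.map_zero_eq_one]

theorem mk_mem_dihedralSet_iff [CharP K 2] {c d : K} (hc : c ≠ 0) (hd : d ≠ 0)
    (g : GL (Fin 2) K) :
    Matrix.ProjGenLinGroup.mk g ∈ dihedralSet d (c / d) ↔
      (g.val 0 1 = g.val 1 0 * d ^ 2 / c ^ 2 ∧ g.val 1 1 = g.val 0 0 + g.val 1 0 / c) ∨
      (g.val 0 1 = g.val 0 0 / c + g.val 1 0 * d ^ 2 / c ^ 2 ∧ g.val 1 1 = g.val 0 0) := by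
  rw [dihedralSet, Set.mem_union, mk_mem_cyclicSet_iff hc hd]
  refine or_congr Iff.rfl ?_
  have hσ : Matrix.ProjGenLinGroup.mk (Matrix.GeneralLinearGroup.upperRightHom (1 / (d * (c / d))))
      * Matrix.ProjGenLinGroup.mk (Matrix.GeneralLinearGroup.upperRightHom (1 / (d * (c / d))))
      = 1 := by
    rw [← map_mul, upperRightHom_mul_self, map_one]
  have : (∃ m ∈ cyclicSet d (c / d), Matrix.ProjGenLinGroup.mk g = m *
      Matrix.ProjGenLinGroup.mk (Matrix.GeneralLinearGroup.upperRightHom (1 / (d * (c / d))))) ↔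
      Matrix.ProjGenLinGroup.mk (g * Matrix.GeneralLinearGroup.upperRightHom (1 / (d * (c / d)))) ∈
        cyclicSet d (c / d) := by
    rw [map_mul]
    constructor
    · rintro ⟨m, hm, h⟩
      rwa [h, mul_assoc, hσ, mul_one]
    · intro h
      exact ⟨_, h, by rw [mul_assoc, hσ, mul_one]⟩
  rw [Set.mem_ofPred_eq, this, mk_mem_cyclicSet_iff hc hd, mul_div_cancel₀ _ hd]
  have h2 : (2 : K) = 0 := CharTwo.two_eq_zero
  simp [Matrix.mul_apply, Fin.sum_univ_two, Matrix.GeneralLinearGroup.upperRightHom]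
  grind

/-- The algebra homomorphism from `K[ω]`, `ω² = j + ω`, to matrices. -/
noncomputable def quadraticToMatrix (c j : K) (hc : c ≠ 0) :
    QuadraticAlgebra K j 1 →ₐ[K] Matrix (Fin 2) (Fin 2) K :=
  QuadraticAlgebra.lift ⟨!![0, j / c; c, 1], by
    ext i k
    fin_cases i <;> fin_cases k <;> simp [Matrix.mul_apply, Fin.sum_univ_two] <;> field_simp⟩

theorem quadraticToMatrix_apply (c j : K) (hc : c ≠ 0) (x : QuadraticAlgebra K j 1) :
    quadraticToMatrix c j hc x = !![x.re, x.im * j / c; x.im * c, x.re + x.im] := by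
  ext i k
  fin_cases i <;> fin_cases k <;>
    simp [quadraticToMatrix, QuadraticAlgebra.lift]
  ring

/-- The homomorphism `K[ω]ˣ → PGL₂(K)`. -/
noncomputable def quadraticToPGL (c j : K) (hc : c ≠ 0) :
    (QuadraticAlgebra K j 1)ˣ →* PGL(2, K) :=
  Matrix.ProjGenLinGroup.mk.comp (Units.map (quadraticToMatrix c j hc : _ →* _))

/-- The linear equations of `mk_mem_cyclicSet_iff` cut out the plane spanned by `1` and the matrix
of `ω`. As `K[ω]` is a field, each nonzero matrix in that plane comes from a unit. -/
theorem range_quadraticToPGL {c d : K} (hc : c ≠ 0) (hd : d ≠ 0)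
    (hirr : ∀ t : K, t ^ 2 ≠ d ^ 2 + 1 * t) :
    ((quadraticToPGL c (d ^ 2) hc).range : Set (PGL(2, K))) = cyclicSet d (c / d) := by
  have : Fact (∀ t : K, t ^ 2 ≠ d ^ 2 + 1 * t) := ⟨hirr⟩
  ext γ
  constructor
  · rintro ⟨x, rfl⟩
    refine (mk_mem_cyclicSet_iff hc hd _).mpr ?_
    simp [quadraticToMatrix_apply]
    field_simp
    simp
  · intro h
    induction γ using Matrix.ProjGenLinGroup.induction_on with
    | mk g =>
    obtain ⟨h1, h2⟩ := (mk_mem_cyclicSet_iff hc hd g).mp h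
    have hx : (⟨g.val 0 0, g.val 1 0 / c⟩ : QuadraticAlgebra K (d ^ 2) 1) ≠ 0 := by
      intro h
      rw [QuadraticAlgebra.ext_iff] at h
      have hdet := g.det_ne_zero
      have h0 : g.val 0 0 = 0 := h.1
      have h3 : g.val 1 0 = 0 := by simpa [hc] using h.2
      rw [Matrix.det_fin_two, h0, h3] at hdet
      simp at hdet
    refine ⟨Units.mk0 _ hx, congrArg Matrix.ProjGenLinGroup.mk (Units.ext ?_)⟩
    simp [quadraticToMatrix_apply]
    ext i k
    fin_cases i <;> fin_cases k <;> simp [h1, h2] <;> field_simp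

theorem ncard_cyclicSet [Finite K] {c d : K} (hc : c ≠ 0) (hd : d ≠ 0)
    (hirr : ∀ t : K, t ^ 2 ≠ d ^ 2 + 1 * t) [CharP K 2] :
    (cyclicSet d (c / d)).ncard = Nat.card K + 1 := by
  have h2 : (2 : K) = 0 := CharTwo.two_eq_zero
  have hdet : ∀ A : K, IsUnit (!![A, 1 / (c / d); c / d, A + 1 / d] : Matrix _ _ K).det := by
    intro A
    rw [Matrix.det_fin_two_of, isUnit_iff_ne_zero]
    intro h
    -- A vanishing determinant `A² + A/d + 1` makes `d A` a root of `t² = d² + t`.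
    apply hirr (d * A)
    field_simp at h
    linear_combination d * h - d * A * h2
  let g : K → GL (Fin 2) K := fun A => Matrix.GeneralLinearGroup.mk'' _ (hdet A)
  have hg : ∀ A, (g A).val = !![A, 1 / (c / d); c / d, A + 1 / d] := fun A => rfl
  let f : Option K → PGL(2, K) := fun
    | none => 1
    | some A => Matrix.ProjGenLinGroup.mk (g A)
  have hcd : c / d ≠ 0 := div_ne_zero hc hd
  have hne : ∀ A, Matrix.ProjGenLinGroup.mk (g A) ≠ 1 := by
    intro A h
    rw [← Matrix.ProjGenLinGroup.mk_one] at h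
    obtain ⟨u, hu⟩ := exists_smul_of_mk_eq_mk h
    have := hu 1 0
    simp [hg, hc, hd] at this
  have hf : Function.Injective f := by
    rintro (_ | A) (_ | B) h
    · rfl
    · exact absurd h.symm (hne B)
    · exact absurd h (hne A)
    · obtain ⟨u, hu⟩ := exists_smul_of_mk_eq_mk h
      have h1 := hu 1 0
      have h0 := hu 0 0
      simp only [hg, Matrix.of_apply, Matrix.cons_val', Matrix.cons_val_zero, Matrix.cons_val_one,
        Matrix.cons_val_fin_one] at h1 h0
      rw [mul_eq_left₀ hcd] at h1
      rw [h1, mul_one] at h0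
      rw [h0]
  have hr : cyclicSet d (c / d) = Set.range f := by
    ext γ
    constructor
    · rintro (rfl | ⟨A, h, hA, rfl⟩)
      · exact ⟨none, rfl⟩
      · exact ⟨some A, congrArg Matrix.ProjGenLinGroup.mk (Units.ext (by rw [hA, hg]))⟩
    · rintro ⟨_ | A, rfl⟩
      · exact Or.inl rfl
      · exact Or.inr ⟨A, g A, hg A, rfl⟩
  rw [hr, ← Nat.card_coe_set_eq, Nat.card_range_of_injective hf, Finite.card_option]

/-- The cyclic part is a quotient of the unit group of the finite field `K[ω]`, hence a cyclic
group. -/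
theorem exists_subgroup_dihedralSet [Finite K] [CharP K 2] {c d : K} (hc : c ≠ 0) (hd : d ≠ 0)
    (hirr : ∀ t : K, t ^ 2 ≠ d ^ 2 + 1 * t) :
    ∃ H : Subgroup (PGL(2, K)), (H : Set (PGL(2, K))) = dihedralSet d (c / d) ∧
      Nonempty (H ≃* DihedralGroup (Nat.card K + 1)) := by
  have h2 : (2 : K) = 0 := CharTwo.two_eq_zero
  have : Fact (∀ t : K, t ^ 2 ≠ d ^ 2 + 1 * t) := ⟨hirr⟩
  have : Finite (QuadraticAlgebra K (d ^ 2) 1) :=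
    Finite.of_equiv _ (QuadraticAlgebra.equivProd (d ^ 2) (1 : K)).symm
  have hC := range_quadraticToPGL hc hd hirr
  have : IsCyclic (quadraticToPGL c (d ^ 2) hc).range :=
    isCyclic_of_surjective _ (quadraticToPGL c (d ^ 2) hc).rangeRestrict_surjective
  have hcard : Nat.card (quadraticToPGL c (d ^ 2) hc).range = Nat.card K + 1 := by
    rw [← ncard_cyclicSet hc hd hirr, ← hC, ← Nat.card_coe_set_eq]
    rfl
  have hmem : ∀ γ, γ ∈ (quadraticToPGL c (d ^ 2) hc).range ↔ γ ∈ cyclicSet d (c / d) := by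
    intro γ
    rw [← hC]; rfl
  have key := exists_subgroup_mulEquiv_dihedralGroup (quadraticToPGL c (d ^ 2) hc).range
    (Matrix.ProjGenLinGroup.mk (Matrix.GeneralLinearGroup.upperRightHom (1 / (d * (c / d)))))
    (by rw [← map_mul, upperRightHom_mul_self, map_one])
    (by
      rw [hmem, mk_mem_cyclicSet_iff hc hd]
      simp [Matrix.GeneralLinearGroup.upperRightHom, hc, hd])
    (by
      intro γ hγ
      rw [hmem] at hγ
      induction γ using Matrix.ProjGenLinGroup.induction_on with
      | mk g =>
      obtain ⟨h1, h3⟩ := (mk_mem_cyclicSet_iff hc hd g).mp hγ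
      -- The involution `t` inverts `g` because `t g` has trace `0`: by Cayley–Hamilton `(t g)²` is
      -- the scalar `det g`.
      rw [← map_mul, ← map_mul, eq_inv_iff_mul_eq_one, ← map_mul,
        ← Matrix.ProjGenLinGroup.mk_one]
      refine (mk_eq_mk_of_smul (Matrix.GeneralLinearGroup.det g) ?_).symm
      have hdet : (Matrix.GeneralLinearGroup.det g : K) = _ := Matrix.det_fin_two g.val
      rw [mul_div_cancel₀ _ hd]
      have hval : (Matrix.GeneralLinearGroup.upperRightHom (1 / c) * g *
          Matrix.GeneralLinearGroup.upperRightHom (1 / c) * g).val =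
          !![1, 1 / c; 0, 1] * !![g.val 0 0, g.val 0 1; g.val 1 0, g.val 1 1] *
            !![1, 1 / c; 0, 1] * !![g.val 0 0, g.val 0 1; g.val 1 0, g.val 1 1] := by
        rw [← Matrix.eta_fin_two]; rfl
      intro i k
      rw [hdet, hval, h1, h3]
      clear hval hdet h1 h3 hγ
      generalize g.val 0 0 = a at *
      generalize g.val 1 0 = b at *
      simp only [Matrix.mul_fin_two]
      fin_cases i <;> fin_cases k <;> simp <;> field_simp <;> grind)
  rw [hC, hcard] at key
  exact key

end PGL

/-! ### Transformation of the associated quadratic forms. -/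

section transform

variable {K Ω : Type*} [Field K] [Field Ω] [Algebra K Ω]

/-- The value of the quadratic form `c X² + X Y + (j/c) Y²` at `(u, v)`. -/
def quadForm (c j u v : K) : K := c * u ^ 2 + u * v + j / c * v ^ 2

/-- The new outer coefficients are the values of the form at the columns of `g`, divided by `det g`;
the middle one is `det g / det g = 1`. Powers of the Möbius denominator cancel in the quotient, as
does `det g`, because `(det g)^(q+1) = (det g)²`. -/
theorem eVal_mobiusGL {n : ℕ} [Finite K] [CharP K 2] [CharP Ω 2] (hK : Nat.card K = 2 ^ n)
    (g : GL (Fin 2) K) (c j : K)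
    (hc' : quadForm c j (g.val 0 0) (g.val 1 0) / g.val.det ≠ 0) {y : Ω}
    (hy : y ∉ Set.range (algebraMap K Ω)) :
    eVal n (mobiusGL g y) c j = eVal n y (quadForm c j (g.val 0 0) (g.val 1 0) / g.val.det)
      (quadForm c j (g.val 0 0) (g.val 1 0) / g.val.det *
        (quadForm c j (g.val 0 1) (g.val 1 1) / g.val.det)) := by
  have h2 : (2 : Ω) = 0 := CharTwo.two_eq_zero
  have hden := mobiusGL_denom_ne_zero g y hy
  have hdet : algebraMap K Ω g.val.det ≠ 0 := by simpa using g.det_ne_zero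
  have hdet' : algebraMap K Ω g.val.det = algebraMap K Ω (g.val 0 0) * algebraMap K Ω (g.val 1 1) +
      algebraMap K Ω (g.val 0 1) * algebraMap K Ω (g.val 1 0) := by
    rw [Matrix.det_fin_two, map_sub, map_mul, map_mul, CharTwo.sub_eq_add]
  rw [eVal, eVal, mul_div_cancel_left₀ _ hc',
    map_div₀ _ (quadForm c j (g.val 0 0) (g.val 1 0)),
    map_div₀ _ (quadForm c j (g.val 0 1) (g.val 1 1))]
  have hdenq : (algebraMap K Ω (g.val 1 0) * y + algebraMap K Ω (g.val 1 1)) ^ (2 ^ n) =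
      algebraMap K Ω (g.val 1 0) * y ^ (2 ^ n) + algebraMap K Ω (g.val 1 1) := by
    rw [add_pow_char_pow, mul_pow, algebraMap_pow_two_pow hK, algebraMap_pow_two_pow hK]
  have hden2 := pow_ne_zero (2 ^ n) hden
  have hzD : mobiusGL g y ^ (2 ^ n) + mobiusGL g y =
      algebraMap K Ω g.val.det * (y ^ (2 ^ n) + y) /
        (algebraMap K Ω (g.val 1 0) * y + algebraMap K Ω (g.val 1 1)) ^ (2 ^ n + 1) := by
    rw [mobiusGL, div_pow, add_pow_char_pow _ _ (p := 2), mul_pow, algebraMap_pow_two_pow hK,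
      algebraMap_pow_two_pow hK, pow_succ _ (2 ^ n), hdet']
    rw [hdenq] at hden2 ⊢
    field_simp
    grind
  have hzP : algebraMap K Ω c * mobiusGL g y ^ 2 + mobiusGL g y + algebraMap K Ω (j / c) =
      algebraMap K Ω g.val.det * (algebraMap K Ω (quadForm c j (g.val 0 0) (g.val 1 0)) /
        algebraMap K Ω g.val.det * y ^ 2 + y +
          algebraMap K Ω (quadForm c j (g.val 0 1) (g.val 1 1)) / algebraMap K Ω g.val.det) /
        (algebraMap K Ω (g.val 1 0) * y + algebraMap K Ω (g.val 1 1)) ^ 2 := by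
    simp only [quadForm, map_add, map_mul, map_pow, mobiusGL]
    have hden' : y * algebraMap K Ω (g.val 1 0) + algebraMap K Ω (g.val 1 1) ≠ 0 := by
      rwa [mul_comm]
    generalize algebraMap K Ω (j / c) = jc
    clear hzD hdenq hden2 hc'
    field_simp
    rw [hdet']
    grind
  rw [hzD, hzP, div_pow, div_pow, mul_pow, mul_pow]
  have hdq : algebraMap K Ω g.val.det ^ (2 ^ n + 1) = algebraMap K Ω g.val.det ^ 2 := by
    rw [pow_succ, algebraMap_pow_two_pow hK, sq]
  rw [hdq, pow_right_comm _ 2 (2 ^ n + 1)]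
  have := pow_ne_zero 2 (pow_ne_zero (2 ^ n + 1) hden)
  rw [div_div_div_cancel_right₀ this, mul_div_mul_left _ _ (pow_ne_zero 2 hdet)]

/-- Invariance of the Arf invariant: the product of the outer coefficients changes only by some `t²
+ t`, which has trace `0`. -/
theorem quadForm_mul_quadForm [CharP K 2] (g : GL (Fin 2) K) {c : K} (hc : c ≠ 0) (j : K) :
    quadForm c j (g.val 0 0) (g.val 1 0) / g.val.det *
        (quadForm c j (g.val 0 1) (g.val 1 1) / g.val.det) =
      j + (((c ^ 2 * g.val 0 0 * g.val 0 1 + j * g.val 1 0 * g.val 1 1 +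
        c * g.val 0 0 * g.val 1 1) / (c * g.val.det)) ^ 2 +
        (c ^ 2 * g.val 0 0 * g.val 0 1 + j * g.val 1 0 * g.val 1 1 +
        c * g.val 0 0 * g.val 1 1) / (c * g.val.det)) := by
  have h2 : (2 : K) = 0 := CharTwo.two_eq_zero
  have hdet := g.det_ne_zero
  simp only [quadForm]
  have hdet' : g.val.det = g.val 0 0 * g.val 1 1 + g.val 0 1 * g.val 1 0 := by
    rw [Matrix.det_fin_two, CharTwo.sub_eq_add]
  generalize g.val.det = D at *
  field_simp
  subst hdet'
  grind

theorem ne_zero_of_mem_traceOne [Algebra (ZMod 2) K] {j : K} (hj : j ∈ traceOne K) : j ≠ 0 := by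
  rintro rfl
  simp [traceOne] at hj

theorem sq_ne_add_of_mem_traceOne [Finite K] [Algebra (ZMod 2) K] {j : K} (hj : j ∈ traceOne K)
    (t : K) : t ^ 2 ≠ j + 1 * t := by
  intro h
  have := congrArg (Algebra.trace (ZMod 2) K) h
  rw [trace_sq, one_mul, map_add, show Algebra.trace (ZMod 2) K j = 1 from hj] at this
  simp at this

theorem quadForm_mul_mem_traceOne [Finite K] [CharP K 2] [Algebra (ZMod 2) K] (g : GL (Fin 2) K)
    {c j : K} (hc : c ≠ 0) (hj : j ∈ traceOne K) :
    quadForm c j (g.val 0 0) (g.val 1 0) / g.val.det *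
        (quadForm c j (g.val 0 1) (g.val 1 1) / g.val.det) ∈ traceOne K := by
  rw [quadForm_mul_quadForm g hc j]
  simp only [traceOne, Set.mem_ofPred_eq, map_add, trace_sq]
  rw [show Algebra.trace (ZMod 2) K j = 1 from hj, CharTwo.add_self_eq_zero, add_zero]

theorem quadForm_fixed_iff [Finite K] [CharP K 2] [Algebra (ZMod 2) K] (g : GL (Fin 2) K)
    {c d : K} (hc : c ≠ 0) (hd : d ^ 2 ∈ traceOne K) :
    (quadForm c (d ^ 2) (g.val 0 0) (g.val 1 0) / g.val.det = c ∧
      quadForm c (d ^ 2) (g.val 0 0) (g.val 1 0) / g.val.det *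
        (quadForm c (d ^ 2) (g.val 0 1) (g.val 1 1) / g.val.det) = d ^ 2) ↔
      Matrix.ProjGenLinGroup.mk g ∈ dihedralSet d (c / d) := by
  have h2 : (2 : K) = 0 := CharTwo.two_eq_zero
  have hd0 : d ≠ 0 := fun h => ne_zero_of_mem_traceOne hd (by rw [h]; ring)
  have hdet := g.det_ne_zero
  have hdet' : g.val.det = g.val 0 0 * g.val 1 1 + g.val 0 1 * g.val 1 0 := by
    rw [Matrix.det_fin_two, CharTwo.sub_eq_add]
  rw [mk_mem_dihedralSet_iff hc hd0, quadForm_mul_quadForm g hc, add_eq_left]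
  simp only [quadForm]
  generalize g.val.det = D at *
  generalize g.val 0 0 = α at *
  generalize g.val 0 1 = β at *
  generalize g.val 1 0 = γ at *
  generalize g.val 1 1 = δ at *
  constructor
  · rintro ⟨h1, h3⟩
    rw [div_eq_iff hdet] at h1
    have h1' : c ^ 2 * α ^ 2 + c * α * γ + d ^ 2 * γ ^ 2 = c ^ 2 * D := by
      field_simp at h1
      linear_combination h1
    have h3' : (c ^ 2 * α * β + d ^ 2 * γ * δ + c * α * δ) *
        (c ^ 2 * α * β + d ^ 2 * γ * δ + c * α * δ + c * D) = 0 := by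
      field_simp at h3
      linear_combination h3
    have hcD : c ^ 2 * D ≠ 0 := mul_ne_zero (pow_ne_zero 2 hc) hdet
    -- Invariance of `j` means `t² + t = 0` for the `t` of `quadForm_mul_quadForm`. The value `t =
    -- 0` gives the reflections, `t = 1` the cyclic part.
    rcases mul_eq_zero.mp h3' with h | h
    · right
      have e1 : δ = α := by
        apply mul_left_cancel₀ hcD
        linear_combination (-δ) * h1' + γ * h - c ^ 2 * α * hdet' - c ^ 2 * α * β * γ * h2
      have e2 : c ^ 2 * β = c * α + d ^ 2 * γ := by
        apply mul_left_cancel₀ hdet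
        rw [e1] at hdet' h
        linear_combination (c ^ 2 * β - (c * α + d ^ 2 * γ)) * hdet' + α * h -
          α ^ 2 * (d ^ 2 * γ + c * α) * h2 + β * (-h1' - c ^ 2 * hdet')
      refine ⟨?_, e1⟩
      field_simp
      linear_combination e2
    · left
      have e1 : c * δ = c * α + γ := by
        apply mul_left_cancel₀ (mul_ne_zero hc hdet)
        linear_combination (-δ) * h1' + γ * h - c ^ 2 * α * hdet' -
          (c ^ 2 * α * β * γ + c * D * γ) * h2
      have e2 : c ^ 2 * β = γ * d ^ 2 := by
        have hγ : γ * (c ^ 2 * β - γ * d ^ 2) = 0 := by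
          grind
        have hδ : c * (δ * (c ^ 2 * β - γ * d ^ 2)) = 0 := by
          grind
        have hδ' := (mul_eq_zero.mp hδ).resolve_left hc
        apply mul_left_cancel₀ hdet
        linear_combination (c ^ 2 * β - γ * d ^ 2) * hdet' + β * hγ + α * hδ'
      constructor
      · field_simp
        linear_combination e2
      · field_simp
        linear_combination e1
  · rintro (⟨rfl, rfl⟩ | ⟨rfl, rfl⟩)
    · subst hdet'
      constructor
      · field_simp
        grind
      · field_simp
        grind
    · subst hdet'
      constructor
      · field_simp
        grind
      · field_simp
        grind

end transform

/-! ### The Möbius action outside `K`. -/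

section mobius

variable {K Ω : Type*} [Field K] [Field Ω] [Algebra K Ω]

theorem mobius_one (y : Ω) : mobius (1 : PGL(2, K)) y = y := by
  rw [← Matrix.ProjGenLinGroup.mk_one, mobius_mk]
  simp [mobiusGL]

theorem mobius_mul (γ δ : PGL(2, K)) {y : Ω} (hy : y ∉ Set.range (algebraMap K Ω)) :
    mobius (γ * δ) y = mobius γ (mobius δ y) := by
  induction γ using Matrix.ProjGenLinGroup.induction_on with | mk g =>
  induction δ using Matrix.ProjGenLinGroup.induction_on with | mk h =>
  rw [← map_mul, mobius_mk, mobius_mk, mobius_mk]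
  have h1 := mobiusGL_denom_ne_zero h y hy
  have h2 := mobiusGL_denom_ne_zero (g * h) y hy
  simp only [mobiusGL, Units.val_mul, Matrix.mul_apply, Fin.sum_univ_two, map_add, map_mul] at *
  rw [div_eq_div_iff h2]
  · field_simp
    ring
  · intro h0
    apply h2
    rw [mul_div_assoc', div_add' _ _ _ h1, div_eq_zero_iff, or_iff_left h1] at h0
    linear_combination h0

theorem mobius_notMem_range (γ : PGL(2, K)) {y : Ω} (hy : y ∉ Set.range (algebraMap K Ω)) :
    mobius γ y ∉ Set.range (algebraMap K Ω) := by
  rintro ⟨x, hx⟩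
  apply hy
  have h := mobius_mul γ⁻¹ γ hy
  rw [inv_mul_cancel, mobius_one, ← hx] at h
  rw [h]
  induction γ⁻¹ using Matrix.ProjGenLinGroup.induction_on with | mk g =>
  -- The denominator need not be nonzero: `algebraMap` also respects division by zero.
  exact ⟨(g.val 0 0 * x + g.val 0 1) / (g.val 1 0 * x + g.val 1 1), by simp [mobius_mk, mobiusGL]⟩

/-- The pair `(c', j')` is chosen before `y`. This uniformity is what makes the action
multiplicative. -/
theorem exists_eVal_mobius {n : ℕ} [Finite K] [CharP K 2] [CharP Ω 2] [Algebra (ZMod 2) K]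
    (hK : Nat.card K = 2 ^ n) (γ : PGL(2, K)) {c j : K} (hc : c ≠ 0) (hj : j ∈ traceOne K) :
    ∃ c' j' : K, c' ≠ 0 ∧ j' ∈ traceOne K ∧
      (∀ y : Ω, y ∉ Set.range (algebraMap K Ω) → eVal n (mobius γ y) c j = eVal n y c' j') ∧
      ∀ d, d ^ 2 = j → (c' = c ∧ j' = j ↔ γ ∈ dihedralSet d (c / d)) := by
  induction γ using Matrix.ProjGenLinGroup.induction_on with | mk g =>
  have h := quadForm_mul_mem_traceOne g hc hj
  -- `c'` is a factor of `j'`, which is nonzero since its trace is `1`.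
  have h0 := left_ne_zero_of_mul (ne_zero_of_mem_traceOne h)
  refine ⟨_, _, h0, h, fun y hy => eVal_mobiusGL hK g c j h0 hy, ?_⟩
  rintro d rfl
  exact quadForm_fixed_iff g hc hj

end mobius

/-! ### Counting roots, and the conclusion. -/

/-- The bound `1 + (q+1)(q/2 - 1) = (q-1) q/2` equals the number of pairs `(c, j)`. -/
theorem natDegree_mcmPoly_add_C_le {F : Type*} [Field F] (n : ℕ) (hn : 0 < n) (a : F) :
    (mcmPoly F n + C a).natDegree ≤ (2 ^ n - 1) * 2 ^ (n - 1) := by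
  obtain ⟨m, rfl⟩ := Nat.exists_eq_succ_of_ne_zero hn.ne'
  rw [natDegree_add_C, mcmPoly]
  have hs : (∑ i ∈ Finset.range (m + 1), (X : F[X]) ^ (2 ^ i - 1)).natDegree ≤ 2 ^ m - 1 := by
    refine natDegree_sum_le_of_forall_le _ _ fun i hi => ?_
    rw [natDegree_X_pow]
    exact Nat.sub_le_sub_right
      (Nat.pow_le_pow_right two_pos (Nat.lt_succ_iff.mp (Finset.mem_range.mp hi))) 1
  refine natDegree_mul_le.trans ?_
  rw [natDegree_X]
  refine (Nat.add_le_add_left (natDegree_pow_le.trans (Nat.mul_le_mul_left _ hs)) 1).trans ?_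
  obtain ⟨k, hk⟩ := Nat.exists_eq_succ_of_ne_zero (pow_ne_zero m two_ne_zero)
  simp only [Nat.succ_eq_add_one, add_tsub_cancel_right, pow_succ] at hk ⊢
  rw [hk]
  simp only [add_tsub_cancel_right, add_mul, one_mul]
  rw [show k * 2 + 1 * 2 - 1 = k * 2 + 1 by omega]
  nlinarith

/-- Translation by an element of trace `1` exchanges the set with its complement. -/
theorem card_traceOne {n : ℕ} (hn : 0 < n) {K : Type*} [Field K] [Finite K] [Algebra (ZMod 2) K]
    (hK : Nat.card K = 2 ^ n) : Nat.card (traceOne K) = 2 ^ (n - 1) := by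
  obtain ⟨j₀, hj₀⟩ := Algebra.trace_surjective (ZMod 2) K 1
  have h2 : (traceOne K).ncard = (traceOne K)ᶜ.ncard := by
    have h1 : ∀ x : ZMod 2, x = 1 ↔ ¬ x + 1 = 1 := by decide
    have : (traceOne K) = (· + j₀) ⁻¹' (traceOne K)ᶜ := by
      ext x
      change Algebra.trace (ZMod 2) K x = 1 ↔ ¬ Algebra.trace (ZMod 2) K (x + j₀) = 1
      rw [map_add, hj₀]
      exact h1 _
    conv_lhs => rw [this]
    exact Set.ncard_preimage_of_injective_subset_range (add_left_injective j₀)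
      fun x _ => ⟨x - j₀, sub_add_cancel x j₀⟩
  have h3 := Set.ncard_add_ncard_compl (traceOne K)
  rw [← h2, hK] at h3
  obtain ⟨m, rfl⟩ := Nat.exists_eq_succ_of_ne_zero hn.ne'
  rw [Nat.card_coe_set_eq]
  simp only [Nat.succ_eq_add_one, add_tsub_cancel_right, pow_succ] at h3 ⊢
  omega

theorem proposition7 (n : ℕ) (hn : 1 < n)
    {K : Type*} [Field K] [Finite K] [Algebra (ZMod 2) K] (hK : Nat.card K = 2 ^ n)
    {F : Type*} [Field F] [CharP F 2] {Ω : Type*} [Field Ω] [Algebra F Ω] [Algebra K Ω]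
    (a : F) (ha : a ≠ 0) (r r₀ r₁ : Ω)
    (hr : r ∈ (X ^ (2 ^ n + 1) + C a * X + C a : F[X]).rootSet Ω)
    (hr₀ : r₀ ∈ (X ^ (2 ^ n + 1) + C a * X + C a : F[X]).rootSet Ω)
    (hr₁ : r₁ ∈ (X ^ (2 ^ n + 1) + C a * X + C a : F[X]).rootSet Ω)
    (h₀ : r ≠ r₀) (h₁ : r ≠ r₁) (h₀₁ : r₀ ≠ r₁)
    (y : Ω) (hy : y = (r₁ - r) / (r₁ - r₀)) :
    -- all denominators in `γ⁻¹ y` and `e(y,c,j)` are nonzero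
    y ∉ Set.range (algebraMap K Ω) ∧ y ^ (2 ^ n) + y ≠ 0 ∧
    -- the `e(y,c,j)` are the roots of `C(x) + a`, each represented once
    (∀ c : Kˣ, ∀ j ∈ traceOne K, eVal n y (c : K) j ∈ (mcmPoly F n + C a).rootSet Ω) ∧
    (∀ x ∈ (mcmPoly F n + C a).rootSet Ω,
      ∃! p : Kˣ × traceOne K, eVal n y (p.1 : K) (p.2 : K) = x) ∧
    -- the main equivalence, and the fact that `𝒟_{d,c/d}` is dihedral of order `2(q+1)`
    (∀ c : Kˣ, ∀ j ∈ traceOne K, ∃ d : K, d ^ 2 = j ∧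
      (∀ γ : PGL(2, K),
        eVal n (mobius γ⁻¹ y) (c : K) j = eVal n y (c : K) j ↔ γ ∈ dihedralSet d (c / d)) ∧
      ∃ H : Subgroup (PGL(2, K)), (H : Set (PGL(2, K))) = dihedralSet d (c / d) ∧
        Nonempty (H ≃* DihedralGroup (2 ^ n + 1)) ∧ Nat.card H = 2 * (2 ^ n + 1)) ∧
    -- `γ · e(y,c,j) = e(γ⁻¹ y,c,j)` is an action on the roots of `C(x) + a`, with stabilizers
    -- `𝒟_{d,c/d}`
    (∃ _ : MulAction (PGL(2, K)) ((mcmPoly F n + C a).rootSet Ω),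
      ∀ (c : Kˣ) (j d : K) (x : (mcmPoly F n + C a).rootSet Ω), j ∈ traceOne K → d ^ 2 = j →
        (x : Ω) = eVal n y (c : K) j →
        (∀ γ : PGL(2, K), ((γ • x : (mcmPoly F n + C a).rootSet Ω) : Ω) =
          eVal n (mobius γ⁻¹ y) (c : K) j) ∧
        (MulAction.stabilizer (PGL(2, K)) x : Set (PGL(2, K))) = dihedralSet d (c / d)) := by

  have : CharP Ω 2 := charP_of_injective_algebraMap (algebraMap F Ω).injective 2
  have : CharP K 2 := charP_of_injective_algebraMap (algebraMap (ZMod 2) K).injective 2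
  have hA : algebraMap F Ω a ≠ 0 := by simpa using ha
  have hroot : ∀ s ∈ (X ^ (2 ^ n + 1) + C a * X + C a : F[X]).rootSet Ω,
      s ^ (2 ^ n + 1) + algebraMap F Ω a * s + algebraMap F Ω a = 0 := by
    intro s hs
    simpa using aeval_eq_zero_of_mem_rootSet hs
  obtain ⟨hD, hp⟩ :=
    param_of_roots n hA (hroot r hr) (hroot r₀ hr₀) (hroot r₁ hr₁) h₀ h₁ h₀₁ hy
  have hN : (y ^ (2 ^ n) + y) ^ (2 ^ n) + (y ^ (2 ^ n) + y) ≠ 0 := by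
    intro h
    rw [h, zero_pow (by positivity)] at hp
    have hD1 := pow_ne_zero (2 ^ n) hD
    exact mul_ne_zero hA (mul_ne_zero hD (pow_ne_zero (2 ^ n) hD1)) hp
  have hyK : y ∉ Set.range (algebraMap K Ω) := by
    rintro ⟨x, rfl⟩
    rw [algebraMap_pow_two_pow hK, CharTwo.add_self_eq_zero] at hD
    exact hD rfl
  have hpoly : mcmPoly F n + C a ≠ 0 := by
    intro h
    have := congrArg (eval 0) h
    simp [mcmPoly, ha] at this
  have hmem : ∀ c : Kˣ, ∀ j ∈ traceOne K,
      eVal n y (c : K) j ∈ (mcmPoly F n + C a).rootSet Ω := by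
    intro c j hj
    rw [mem_rootSet]
    refine ⟨hpoly, ?_⟩
    simpa [mcmPoly] using eVal_root hK hA hD hp c.ne_zero hj
  let E : Kˣ × traceOne K → Ω := fun p => eVal n y (p.1 : K) (p.2 : K)
  have hinj : Function.Injective E := by
    rintro ⟨c, j, hj⟩ ⟨c', j', hj'⟩ h
    obtain ⟨h1, h2⟩ := eVal_injective hK hyK hD hN c.ne_zero c'.ne_zero hj hj' h
    exact Prod.ext (Units.ext h1) (Subtype.ext h2)
  have hrange : Set.range E = (mcmPoly F n + C a).rootSet Ω := by
    refine Set.eq_of_subset_of_ncard_le ?_ ?_ (rootSet_finite _ _)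
    · rintro _ ⟨p, rfl⟩
      exact hmem p.1 p.2 p.2.2
    · rw [← Nat.card_coe_set_eq (Set.range E), Nat.card_range_of_injective hinj, Nat.card_prod,
        card_traceOne (by omega) hK, Nat.card_units, hK]
      exact (ncard_rootSet_le _ _).trans (natDegree_mcmPoly_add_C_le n (by omega) a)
  have hstab : ∀ c : Kˣ, ∀ j ∈ traceOne K, ∀ d : K, d ^ 2 = j →
      (∀ γ : PGL(2, K),
        eVal n (mobius γ⁻¹ y) (c : K) j = eVal n y (c : K) j ↔ γ ∈ dihedralSet d (c / d)) ∧
      ∃ H : Subgroup (PGL(2, K)), (H : Set (PGL(2, K))) = dihedralSet d (c / d) ∧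
        Nonempty (H ≃* DihedralGroup (2 ^ n + 1)) ∧ Nat.card H = 2 * (2 ^ n + 1) := by
    intro c j hj d hd
    have hd0 : d ≠ 0 := by
      rintro rfl
      exact ne_zero_of_mem_traceOne hj (by rw [← hd]; simp)
    obtain ⟨H, hH, ⟨e⟩⟩ := exists_subgroup_dihedralSet c.ne_zero hd0
      (by rw [hd]; exact sq_ne_add_of_mem_traceOne hj)
    rw [hK] at e
    refine ⟨fun γ => ?_, H, hH, ⟨e⟩, by rw [Nat.card_congr e.toEquiv, DihedralGroup.nat_card]⟩
    obtain ⟨c', j', hc', hj', h1, h2⟩ := exists_eVal_mobius (Ω := Ω) hK γ⁻¹ c.ne_zero hj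
    -- The criterion concerns `γ⁻¹`; it passes to `γ` because `dihedralSet` is a subgroup.
    rw [h1 y hyK, ← hH, SetLike.mem_coe, ← H.inv_mem_iff, ← SetLike.mem_coe, hH, ← h2 d hd]
    constructor
    · exact eVal_injective hK hyK hD hN hc' c.ne_zero hj' hj
    · rintro ⟨rfl, rfl⟩
      rfl
  have hex : ∀ x : (mcmPoly F n + C a).rootSet Ω, ∃ p, E p = x := fun x => by
    rw [← Set.mem_range, hrange]; exact x.2
  choose p hE using hex
  have hE' : ∀ (x : (mcmPoly F n + C a).rootSet Ω) (c j : K), c ≠ 0 → j ∈ traceOne K →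
      (x : Ω) = eVal n y c j → ((p x).1 : K) = c ∧ ((p x).2 : K) = j := fun x c j hc hj h =>
    eVal_injective hK hyK hD hN (p x).1.ne_zero hc (p x).2.2 hj ((hE x).trans h)
  have hmob : ∀ (γ : PGL(2, K)) (q : Kˣ × traceOne K),
      eVal n (mobius γ y) (q.1 : K) (q.2 : K) ∈ (mcmPoly F n + C a).rootSet Ω := by
    intro γ q
    obtain ⟨c', j', hc', hj', h1, -⟩ := exists_eVal_mobius (Ω := Ω) hK γ q.1.ne_zero q.2.2
    rw [h1 y hyK]
    exact hmem (Units.mk0 c' hc') j' hj'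
  let act : MulAction (PGL(2, K)) ((mcmPoly F n + C a).rootSet Ω) :=
    { smul := fun γ x => ⟨eVal n (mobius γ⁻¹ y) ((p x).1 : K) ((p x).2 : K), hmob γ⁻¹ (p x)⟩
      one_smul := fun x => Subtype.ext <| by
        change eVal n (mobius 1⁻¹ y) ((p x).1 : K) ((p x).2 : K) = x
        rw [inv_one, mobius_one]
        exact hE x
      mul_smul := fun γ δ x => by
        obtain ⟨c', j', hc', hj', h1, -⟩ :=
          exists_eVal_mobius (Ω := Ω) hK δ⁻¹ (p x).1.ne_zero (p x).2.2
        have h2 := hE' ⟨_, hmob δ⁻¹ (p x)⟩ c' j' hc' hj' (h1 y hyK)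
        refine Subtype.ext ?_
        change eVal n (mobius (γ * δ)⁻¹ y) ((p x).1 : K) ((p x).2 : K) =
          eVal n (mobius γ⁻¹ y) ((p ⟨_, hmob δ⁻¹ (p x)⟩).1 : K) ((p ⟨_, hmob δ⁻¹ (p x)⟩).2 : K)
        -- The identity `e(δ⁻¹z, c, j) = e(z, c', j')` is used at `z = γ⁻¹y`, with the `(c', j')`
        -- found at `z = y`.
        rw [h2.1, h2.2, mul_inv_rev, mobius_mul _ _ hyK, h1 _ (mobius_notMem_range _ hyK)] }
  refine ⟨hyK, hD, hmem, ?_, ?_, act, ?_⟩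
  · intro x hx
    rw [← hrange] at hx
    obtain ⟨q, rfl⟩ := hx
    exact ⟨q, rfl, fun q' h => hinj h⟩
  · intro c j hj
    obtain ⟨d, hd⟩ := surjective_frobenius K 2 j
    exact ⟨d, hd, hstab c j hj d hd⟩
  · intro c j d x hj hd hx
    obtain ⟨h1, h2⟩ := hE' x c j c.ne_zero hj hx
    have hsmul : ∀ γ : PGL(2, K), ((γ • x : (mcmPoly F n + C a).rootSet Ω) : Ω) =
        eVal n (mobius γ⁻¹ y) (c : K) j := by
      intro γ
      change eVal n (mobius γ⁻¹ y) ((p x).1 : K) ((p x).2 : K) = _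
      rw [h1, h2]
    refine ⟨hsmul, ?_⟩
    ext γ
    rw [SetLike.mem_coe, MulAction.mem_stabilizer_iff, Subtype.ext_iff, hsmul, hx]
    exact (hstab c j hj d hd).1 γ
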